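/- Let $S$ be a finite alphabet with at least two letters and let $T$ be the regular rooted tree whose vertices are the finite words over $S$, a word being joined to the words obtained by appending one letter on its right. Let $\operatorname{Aut}(T)$ be the group of automorphisms of the rooted tree $T$, and let $G\le \operatorname{Aut}(T)$, considered as a discrete group. $G$ is spherically transitive if it acts transitively on the words of length $n$ for every $n$. $G$ is fractal if for every vertex $\sigma$ the group of restrictions to the subtree below $\sigma$ of the elements of $\operatorname{Stab}_G(\sigma)$ is exactly $G$, when this subtree is identified with $T$ through $\sigma\tau\leftrightarrow\tau$. For $g\in\operatorname{Aut}(T)$ let $g^\sigma$ be the automorphism with $g^\sigma(\sigma\tau)=\sigma g(\tau)$ that fixes all words not beginning with $\sigma$. $G$ is weakly branch if for every vertex $\sigma$ the rigid stabiliser $\{g^\sigma : g\in G\}\cap G$ is infinite. For a ray $e\in S^{\mathbb N}$ (an infinite geodesic starting at the root) the parabolic subgroup $P_e\le G$ is the stabiliser of $e$ in $G$. For $P\le G$, $\rho_{G/P}$ is the quasi-regular representation of $G$ on $\ell^2(G/P)$, that is, $(\rho_{G/P}(g)f)(x)=f(g^{-1}x)$. A unitary representation is irreducible if its space is nonzero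 and has no closed invariant subspaces other than $0$ and the whole space; two unitary representations of $G$ are equivalent if a unitary operator intertwines them. Then: 1. There is a countable subgroup $G\le\operatorname{Aut}(T)$ that is spherically transitive, fractal and weakly branch. 2. For every spherically transitive, fractal and weakly branch subgroup $G\le\operatorname{Aut}(T)$ and every ray $e$, the representation $\rho_{G/P_e}$ is irreducible. If moreover $G$ is countable, there is an uncountable set $E\subseteq S^{\mathbb N}$ of rays such that the representations $\rho_{G/P_e}$, $e\in E$, are pairwise non-equivalent. In particular, there are uncountably many pairwise non-equivalent irreducible unitary representations of the form $\rho_{G/P}$, with $G$ fractal and weakly branch and $P$ a parabolic subgroup of $G$. -/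

import Mathlib

open scoped ENNReal

noncomputable section

namespace TreeGroup

universe u

/-- The rooted tree on an alphabet `S`: vertices are the finite words over `S`, and two words are
joined by an edge when one is obtained from the other by appending one letter on the right.
The root is the empty word. -/
def tree (S : Type u) : SimpleGraph (List S) where
  Adj v w := (∃ s : S, w = v ++ [s]) ∨ (∃ s : S, v = w ++ [s])
  symm := ⟨fun _ _ h => h.symm⟩
  loopless := ⟨fun v h => by
    rcases h with ⟨s, hs⟩ | ⟨s, hs⟩ <;> simpa using congrArg List.length hs⟩

/-- The automorphism group of the rooted tree: the permutations of the vertices which fix the root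
and preserve adjacency. Any subgroup acts on the set `List S` of vertices by evaluation. -/
def treeAut (S : Type u) : Subgroup (Equiv.Perm (List S)) where
  carrier := {g | g [] = [] ∧ ∀ v w, (tree S).Adj (g v) (g w) ↔ (tree S).Adj v w}
  one_mem' := ⟨rfl, fun _ _ => Iff.rfl⟩
  mul_mem' := by
    rintro a b ⟨ha, ha'⟩ ⟨hb, hb'⟩
    refine ⟨by rw [Equiv.Perm.mul_apply, hb, ha], fun v w => ?_⟩
    rw [Equiv.Perm.mul_apply, Equiv.Perm.mul_apply, ha', hb']
  inv_mem' := by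
    rintro a ⟨ha, ha'⟩
    refine ⟨by rw [Equiv.Perm.inv_eq_iff_eq, ha], fun v w => ?_⟩
    rw [← ha']
    simp

variable {S : Type u}

/-- `G` acts transitively on each level of the tree. -/
def IsSphericallyTransitive (G : Subgroup (treeAut S)) : Prop :=
  ∀ (n : ℕ) (v w : List S), v.length = n → w.length = n → ∃ g : G, g • v = w

/-- `g` fixes the vertex `σ`, and its restriction `g_{|σ}` to the subtree below `σ`, identified
with the whole tree, is `h`. -/
def HasSection (g : treeAut S) (σ : List S) (h : treeAut S) : Prop :=
  g • σ = σ ∧ ∀ τ : List S, g • (σ ++ τ) = σ ++ h • τ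

/-- `G` is fractal: for every vertex `σ`, the restrictions to the subtree below `σ` of the elements
of the stabiliser of `σ` in `G` form, after identification of this subtree with the whole tree,
exactly the group `G`. -/
def IsFractal (G : Subgroup (treeAut S)) : Prop :=
  ∀ σ : List S, {h : treeAut S | ∃ g ∈ G, HasSection g σ h} = (G : Set (treeAut S))

/-- `k = g^σ`: the automorphism `k` acts as `g` on the subtree below `σ`, and trivially on the
vertices outside this subtree. -/
def IsCopyAt (k : treeAut S) (σ : List S) (g : treeAut S) : Prop :=
  (∀ τ : List S, k • (σ ++ τ) = σ ++ g • τ) ∧ ∀ τ : List S, ¬ σ <+: τ → k • τ = τ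

/-- The rigid stabiliser `{g^σ | g ∈ G} ∩ G` of the vertex `σ` in `G`. -/
def rist (G : Subgroup (treeAut S)) (σ : List S) : Set (treeAut S) :=
  {k | ∃ g ∈ G, IsCopyAt k σ g} ∩ G

/-- `G` is weakly branch: all its rigid stabilisers are infinite. -/
def IsWeaklyBranch (G : Subgroup (treeAut S)) : Prop :=
  ∀ σ : List S, (rist G σ).Infinite

/-- The vertex `e₀ e₁ … e_{n-1}` of level `n` on the ray `e`. -/
def rayVertex (e : ℕ → S) (n : ℕ) : List S := (List.range n).map e

/-- The parabolic subgroup of `G` associated with the ray `e`: the stabiliser in `G` of the infinite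
geodesic from the root through the vertices `e₀ e₁ … e_{n-1}`. -/
def parabolic (G : Subgroup (treeAut S)) (e : ℕ → S) : Subgroup G :=
  ⨅ n : ℕ, MulAction.stabilizer G (rayVertex e n)

end TreeGroup

namespace UnitaryRep

universe u v w

/-- A unitary representation `π` is irreducible: its space is nonzero and the only closed invariant
subspaces are zero and the whole space. -/
def IsIrreducible {G : Type u} [Group G] {H : Type v} [NormedAddCommGroup H]
    [InnerProductSpace ℂ H] (π : G →* (H ≃ₗᵢ[ℂ] H)) : Prop :=
  Nontrivial H ∧ ∀ K : Submodule ℂ H, IsClosed (K : Set H) →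
    (∀ (g : G), ∀ x ∈ K, π g x ∈ K) → K = ⊥ ∨ K = ⊤

/-- Two unitary representations are equivalent: there is a unitary operator intertwining them. -/
def Equivalent {G : Type u} [Group G] {H₁ : Type v} [NormedAddCommGroup H₁]
    [InnerProductSpace ℂ H₁] {H₂ : Type w} [NormedAddCommGroup H₂] [InnerProductSpace ℂ H₂]
    (π₁ : G →* (H₁ ≃ₗᵢ[ℂ] H₁)) (π₂ : G →* (H₂ ≃ₗᵢ[ℂ] H₂)) : Prop :=
  ∃ U : H₁ ≃ₗᵢ[ℂ] H₂, ∀ (g : G) (x : H₁), U (π₁ g x) = π₂ g (U x)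

variable {G : Type u} [Group G]

/-- The Hilbert space `ℓ²(G/P)`. -/
abbrev cosetSpace (P : Subgroup G) : Type u := lp (fun _ : G ⧸ P => ℂ) 2

/-- Left translation by `g` on `ℓ²(G/P)`, `(g f)(x) = f(g⁻¹ x)`. -/
def translate (P : Subgroup G) (g : G) (f : cosetSpace P) : cosetSpace P :=
  ⟨fun x => f (g⁻¹ • x), by
    have h2 : (0 : ℝ) < (2 : ℝ≥0∞).toReal := by norm_num
    refine memℓp_gen ?_
    exact ((lp.memℓp f).summable h2).comp_injective (MulAction.injective (g⁻¹ : G))⟩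

theorem translate_apply (P : Subgroup G) (g : G) (f : cosetSpace P) (x : G ⧸ P) :
    translate P g f x = f (g⁻¹ • x) := rfl

theorem translate_one (P : Subgroup G) (f : cosetSpace P) : translate P 1 f = f := by
  ext x; simp [translate_apply]

theorem translate_mul (P : Subgroup G) (g h : G) (f : cosetSpace P) :
    translate P (g * h) f = translate P g (translate P h f) := by
  ext x; simp [translate_apply, mul_smul]

theorem norm_translate (P : Subgroup G) (g : G) (f : cosetSpace P) :
    ‖translate P g f‖ = ‖f‖ := by
  have h2 : (0 : ℝ) < (2 : ℝ≥0∞).toReal := by norm_num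
  rw [lp.norm_eq_tsum_rpow h2, lp.norm_eq_tsum_rpow h2]
  congr 1
  exact (MulAction.toPerm (g⁻¹ : G)).tsum_eq (fun x : G ⧸ P => ‖f x‖ ^ (2 : ℝ≥0∞).toReal)

/-- The quasi-regular representation `ρ_{G/P}` of the discrete group `G` on `ℓ²(G/P)`. -/
def quasiRegular (P : Subgroup G) : G →* (cosetSpace P ≃ₗᵢ[ℂ] cosetSpace P) where
  toFun g :=
    { toFun := translate P g
      invFun := translate P g⁻¹
      map_add' := fun _ _ => rfl
      map_smul' := fun _ _ => rfl
      left_inv := fun f => by rw [← translate_mul, inv_mul_cancel, translate_one]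
      right_inv := fun f => by rw [← translate_mul, mul_inv_cancel, translate_one]
      norm_map' := norm_translate P g }
  map_one' := by ext f : 1; exact translate_one P f
  map_mul' := fun g h => by ext f : 1; exact translate_mul P g h f

end UnitaryRep

end

/-! ### Levels and prefixes under tree automorphisms -/

namespace TreeGroup

universe u

variable {S : Type u}

/-! The finitary automorphisms form the required countable group. The rest depends on finite orbits
of `P_e` on `G/P_f`. If a translate `xf` differs from `e`, subtrees far along `xf` miss `e`;
elements of `G` supported ever deeper there lie in `P_e` and move `xf`, so the orbit of `xP_f` is
infinite (`forall_smul_rayVertex_eq_of_finite_orbit`). A `P_e`-invariant vector of `ℓ²(G/P_f)` lives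
on finite orbits.

With `e = f`, such vectors are multiples of the base point mass `δ`. The projection of `δ` to a
closed invariant subspace is one of them, which forces irreducibility. An equivalence sends `δ` to a
nonzero `P_e`-invariant vector of `ℓ²(G/P_f)`, so `e` and `f` share a `G`-orbit. These orbits are
countable when `G` is, while the rays are uncountable. -/

theorem exists_apply_append_singleton (g : treeAut S) (v : List S) (s : S) :
    ∃ t : S, g • (v ++ [s]) = g • v ++ [t] := by
  induction v using List.reverseRecOn generalizing s with
  | nil =>
    have h : (tree S).Adj (g.1 []) (g.1 [s]) := (g.2.2 _ _).2 (Or.inl ⟨s, rfl⟩)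
    rcases h with ⟨t, ht⟩ | ⟨t, ht⟩
    · exact ⟨t, ht⟩
    · rw [g.2.1] at ht
      simp at ht
  | append_singleton u r ih =>
    have h : (tree S).Adj (g.1 (u ++ [r])) (g.1 (u ++ [r] ++ [s])) :=
      (g.2.2 _ _).2 (Or.inl ⟨s, rfl⟩)
    rcases h with ⟨t, ht⟩ | ⟨t, ht⟩
    · exact ⟨t, ht⟩
    -- The image would be the parent of the image of `u ++ [r]`, which by induction is that of `u`;
    -- this contradicts injectivity.
    · obtain ⟨t', ht'⟩ := ih r
      have h1 : g.1 u ++ [t'] = g.1 (u ++ [r] ++ [s]) ++ [t] := ht'.symm.trans ht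
      have h2 : g.1 u = g.1 (u ++ [r] ++ [s]) := (List.append_inj' h1 rfl).1
      have h3 := congrArg List.length (g.1.injective h2)
      simp at h3

theorem smul_nil (g : treeAut S) : g • ([] : List S) = [] := g.2.1

theorem length_smul (g : treeAut S) (v : List S) : (g • v).length = v.length := by
  induction v using List.reverseRecOn with
  | nil => rw [smul_nil]
  | append_singleton u r ih =>
    obtain ⟨t, ht⟩ := exists_apply_append_singleton g u r
    rw [ht]
    simp [ih]

theorem smul_prefix_smul_append (g : treeAut S) (v w : List S) : g • v <+: g • (v ++ w) := by
  induction w using List.reverseRecOn with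
  | nil => simp
  | append_singleton u r ih =>
    obtain ⟨t, ht⟩ := exists_apply_append_singleton g (v ++ u) r
    rw [← List.append_assoc, ht]
    exact ih.trans (List.prefix_append _ _)

theorem smul_prefix_smul (g : treeAut S) {v w : List S} (h : v <+: w) : g • v <+: g • w := by
  obtain ⟨u, rfl⟩ := h
  exact smul_prefix_smul_append g v u

/-! ### Constructing automorphisms -/

theorem mem_treeAut_of_forall_append_singleton (g : Equiv.Perm (List S)) (h0 : g [] = [])
    (h1 : ∀ v s, ∃ t, g (v ++ [s]) = g v ++ [t])
    (h2 : ∀ v s, ∃ t, g.symm (v ++ [s]) = g.symm v ++ [t]) : g ∈ treeAut S := by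
  have key : ∀ k : Equiv.Perm (List S), (∀ v s, ∃ t, k (v ++ [s]) = k v ++ [t]) →
      ∀ v w, (tree S).Adj v w → (tree S).Adj (k v) (k w) := by
    rintro k hk v w (⟨s, rfl⟩ | ⟨s, rfl⟩)
    · exact Or.inl (hk v s)
    · exact Or.inr (hk w s)
  refine ⟨h0, fun v w => ⟨fun h => ?_, key g h1 v w⟩⟩
  simpa using key g.symm h2 _ _ h

/-- The automorphism acting by `π` on the first letter of each nonempty word. -/
def rootPerm (π : Equiv.Perm S) : treeAut S :=
  ⟨{  toFun := fun v => v.casesOn [] fun s τ => π s :: τ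
      invFun := fun v => v.casesOn [] fun s τ => π.symm s :: τ
      left_inv := by rintro (_ | ⟨s, τ⟩) <;> simp
      right_inv := by rintro (_ | ⟨s, τ⟩) <;> simp },
    mem_treeAut_of_forall_append_singleton _ rfl
      (by rintro (_ | ⟨a, τ⟩) s
          · exact ⟨_, rfl⟩
          · exact ⟨s, rfl⟩)
      (by rintro (_ | ⟨a, τ⟩) s
          · exact ⟨_, rfl⟩
          · exact ⟨s, rfl⟩)⟩

theorem rootPerm_smul_cons (π : Equiv.Perm S) (s : S) (τ : List S) :
    rootPerm π • (s :: τ) = π s :: τ := rfl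

open Classical in
/-- The map acting as `g` on the words below the letter `s` and trivially elsewhere. -/
noncomputable def belowFun (s : S) (g : treeAut S) (v : List S) : List S :=
  v.casesOn [] fun t τ => if t = s then t :: g • τ else t :: τ

theorem belowFun_nil (s : S) (g : treeAut S) : belowFun s g [] = [] := rfl

theorem belowFun_self (s : S) (g : treeAut S) (τ : List S) :
    belowFun s g (s :: τ) = s :: g • τ := by simp [belowFun]

theorem belowFun_of_ne {s t : S} (h : t ≠ s) (g : treeAut S) (τ : List S) :
    belowFun s g (t :: τ) = t :: τ := by simp [belowFun, h]

theorem belowFun_belowFun (s : S) (g h : treeAut S) (v : List S) :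
    belowFun s g (belowFun s h v) = belowFun s (g * h) v := by
  rcases v with _ | ⟨t, τ⟩
  · rfl
  · by_cases hts : t = s
    · subst hts
      simp only [belowFun_self, mul_smul]
    · simp only [belowFun_of_ne hts]

theorem belowFun_one (s : S) (v : List S) : belowFun s 1 v = v := by
  rcases v with _ | ⟨t, τ⟩
  · rfl
  · by_cases hts : t = s
    · subst hts
      simp only [belowFun_self, one_smul]
    · simp only [belowFun_of_ne hts]

theorem exists_belowFun_append_singleton (s : S) (g : treeAut S) (v : List S) (r : S) :
    ∃ t, belowFun s g (v ++ [r]) = belowFun s g v ++ [t] := by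
  rcases v with _ | ⟨a, τ⟩
  · by_cases hr : r = s
    · subst hr
      exact ⟨r, by simp [belowFun_self, belowFun_nil, smul_nil]⟩
    · exact ⟨r, by simp [belowFun_of_ne hr, belowFun_nil]⟩
  · by_cases ha : a = s
    · subst ha
      obtain ⟨t, ht⟩ := exists_apply_append_singleton g τ r
      exact ⟨t, by rw [List.cons_append, belowFun_self, belowFun_self, ht, List.cons_append]⟩
    · exact ⟨r, by rw [List.cons_append, belowFun_of_ne ha, belowFun_of_ne ha, List.cons_append]⟩

/-- The automorphism acting as `g` on the words below the letter `s` and trivially elsewhere. -/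
noncomputable def below (s : S) (g : treeAut S) : treeAut S :=
  ⟨{  toFun := belowFun s g
      invFun := belowFun s g⁻¹
      left_inv := fun v => by rw [belowFun_belowFun, inv_mul_cancel, belowFun_one]
      right_inv := fun v => by rw [belowFun_belowFun, mul_inv_cancel, belowFun_one] },
    mem_treeAut_of_forall_append_singleton _ rfl (exists_belowFun_append_singleton s g)
      (exists_belowFun_append_singleton s g⁻¹)⟩

theorem below_smul (s : S) (g : treeAut S) (v : List S) : below s g • v = belowFun s g v := rfl

theorem treeAut_ext {g h : treeAut S} (H : ∀ v : List S, g • v = h • v) : g = h :=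
  Subtype.ext (Equiv.ext H)

theorem below_injective (s : S) : Function.Injective (below s) := by
  intro g h hgh
  refine treeAut_ext fun v => ?_
  have h1 : below s g • (s :: v) = below s h • (s :: v) := by rw [hgh]
  simpa [below_smul, belowFun_self] using h1

/-- The automorphism `g^σ`. -/
noncomputable def copyAt (σ : List S) (g : treeAut S) : treeAut S := σ.foldr below g

theorem copyAt_cons (s : S) (σ : List S) (g : treeAut S) :
    copyAt (s :: σ) g = below s (copyAt σ g) := rfl

theorem isCopyAt_copyAt (σ : List S) (g : treeAut S) : IsCopyAt (copyAt σ g) σ g := by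
  induction σ with
  | nil => exact ⟨fun _ => rfl, fun τ h => absurd τ.nil_prefix h⟩
  | cons s σ ih =>
    refine ⟨fun τ => ?_, fun τ h => ?_⟩
    · rw [copyAt_cons, List.cons_append, below_smul, belowFun_self, ih.1, List.cons_append]
    · rw [copyAt_cons, below_smul]
      rcases τ with _ | ⟨t, τ⟩
      · rfl
      · by_cases hts : t = s
        · subst hts
          rw [belowFun_self, ih.2 τ fun hσ => h (List.cons_prefix_cons.2 ⟨rfl, hσ⟩)]
        · exact belowFun_of_ne hts _ _

theorem copyAt_injective (σ : List S) : Function.Injective (copyAt σ) := by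
  induction σ with
  | nil => exact fun _ _ h => h
  | cons s σ ih => exact (below_injective s).comp ih

/-! ### The group of finitary automorphisms -/

/-- `g` only changes the first `n` letters of each word, in a way that depends only on these. -/
def HasDepth (g : treeAut S) (n : ℕ) : Prop :=
  ∀ σ τ : List S, σ.length = n → g • (σ ++ τ) = g • σ ++ τ

theorem HasDepth.mono {g : treeAut S} {m n : ℕ} (h : HasDepth g m) (hmn : m ≤ n) :
    HasDepth g n := by
  intro σ τ hσ
  have h1 : (σ.take m).length = m := by simp [hσ, hmn]
  have h2 := h _ (σ.drop m ++ τ) h1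
  have h3 := h _ (σ.drop m) h1
  rw [← List.append_assoc, List.take_append_drop] at h2
  rw [List.take_append_drop] at h3
  rw [h2, h3, List.append_assoc]

theorem HasDepth.mul {g h : treeAut S} {n : ℕ} (hg : HasDepth g n) (hh : HasDepth h n) :
    HasDepth (g * h) n := by
  intro σ τ hσ
  rw [mul_smul, mul_smul, hh σ τ hσ, hg _ τ ((length_smul h σ).trans hσ)]

theorem HasDepth.inv {g : treeAut S} {n : ℕ} (hg : HasDepth g n) : HasDepth g⁻¹ n := by
  intro σ τ hσ
  rw [inv_smul_eq_iff, hg _ τ ((length_smul _ σ).trans hσ), smul_inv_smul]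

variable (S) in
/-- The group of finitary automorphisms. -/
def finitary : Subgroup (treeAut S) where
  carrier := {g | ∃ n, HasDepth g n}
  one_mem' := ⟨0, fun _ _ _ => rfl⟩
  mul_mem' := by
    rintro g h ⟨m, hm⟩ ⟨n, hn⟩
    exact ⟨max m n, (hm.mono (le_max_left _ _)).mul (hn.mono (le_max_right _ _))⟩
  inv_mem' := by
    rintro g ⟨n, hn⟩
    exact ⟨n, hn.inv⟩

theorem mem_finitary {g : treeAut S} : g ∈ finitary S ↔ ∃ n, HasDepth g n := Iff.rfl

theorem rootPerm_mem_finitary (π : Equiv.Perm S) : rootPerm π ∈ finitary S := by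
  refine ⟨1, fun σ τ hσ => ?_⟩
  obtain ⟨s, rfl⟩ := List.length_eq_one_iff.1 hσ
  rfl

theorem below_mem_finitary (s : S) {g : treeAut S} (hg : g ∈ finitary S) :
    below s g ∈ finitary S := by
  obtain ⟨n, hn⟩ := hg
  refine ⟨n + 1, fun σ τ hσ => ?_⟩
  rcases σ with _ | ⟨t, σ⟩
  · simp at hσ
  · rw [below_smul, below_smul, List.cons_append]
    by_cases hts : t = s
    · subst hts
      rw [belowFun_self, belowFun_self, hn σ τ (by simpa using hσ), List.cons_append]
    · rw [belowFun_of_ne hts, belowFun_of_ne hts, List.cons_append]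

theorem copyAt_mem_finitary (σ : List S) {g : treeAut S} (hg : g ∈ finitary S) :
    copyAt σ g ∈ finitary S := by
  induction σ with
  | nil => exact hg
  | cons s σ ih => exact below_mem_finitary s ih

theorem exists_finitary_smul_eq (v w : List S) (h : v.length = w.length) :
    ∃ g ∈ finitary S, g • v = w := by
  classical
  induction v generalizing w with
  | nil => exact ⟨1, one_mem _, by rw [one_smul, List.length_eq_zero_iff.1 h.symm]⟩
  | cons s v ih =>
    rcases w with _ | ⟨t, w⟩
    · simp at h
    · obtain ⟨g, hg, hgv⟩ := ih w (by simpa using h)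
      refine ⟨rootPerm (Equiv.swap s t) * below s g,
        mul_mem (rootPerm_mem_finitary _) (below_mem_finitary s hg), ?_⟩
      rw [mul_smul, below_smul, belowFun_self, hgv, rootPerm_smul_cons, Equiv.swap_apply_left]

theorem isSphericallyTransitive_finitary : IsSphericallyTransitive (finitary S) := by
  rintro n v w hv hw
  obtain ⟨g, hg, h⟩ := exists_finitary_smul_eq v w (hv.trans hw.symm)
  exact ⟨⟨g, hg⟩, h⟩

/-- An element of depth `n` also has depth `σ.length + n`, so its section at `σ` has depth `n`.
Conversely, `copyAt σ h` has section `h`. -/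
theorem isFractal_finitary : IsFractal (finitary S) := by
  intro σ
  ext h
  constructor
  · rintro ⟨g, ⟨n, hn⟩, -, hs⟩
    refine ⟨n, fun τ ρ hτ => ?_⟩
    have h1 := hn.mono (Nat.le_add_left n σ.length) (σ ++ τ) ρ (by simp [hτ])
    rw [List.append_assoc, hs, hs, List.append_assoc] at h1
    exact List.append_cancel_left h1
  · intro hh
    refine ⟨copyAt σ h, copyAt_mem_finitary σ hh, ?_, (isCopyAt_copyAt σ h).1⟩
    simpa [smul_nil] using (isCopyAt_copyAt σ h).1 []

/-- The map `below a` is an injective self-map of the group but not surjective: its values fix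
`[a]`, which a swap of `a` and `b` moves. -/
theorem infinite_finitary [Nontrivial S] : (finitary S : Set (treeAut S)).Infinite := by
  classical
  obtain ⟨a, b, hab⟩ := exists_pair_ne S
  intro hfin
  have : Finite (finitary S) := hfin
  have hinj : Function.Injective fun g : finitary S =>
      (⟨below a g, below_mem_finitary a g.2⟩ : finitary S) := fun g h hgh =>
    Subtype.ext (below_injective a (congrArg Subtype.val hgh))
  obtain ⟨g, hg⟩ := (Finite.injective_iff_surjective.1 hinj)
    ⟨rootPerm (Equiv.swap a b), rootPerm_mem_finitary _⟩
  have h1 : below a g.1 = rootPerm (Equiv.swap a b) := congrArg Subtype.val hg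
  have h2 : below a g.1 • [a] = rootPerm (Equiv.swap a b) • [a] := by rw [h1]
  rw [below_smul, belowFun_self, rootPerm_smul_cons, Equiv.swap_apply_left] at h2
  exact hab (List.cons.inj h2).1

theorem isWeaklyBranch_finitary [Nontrivial S] : IsWeaklyBranch (finitary S) := by
  intro σ
  refine (infinite_finitary.image (copyAt_injective σ).injOn).mono ?_
  rintro _ ⟨g, hg, rfl⟩
  exact ⟨⟨g, hg, isCopyAt_copyAt σ g⟩, copyAt_mem_finitary σ hg⟩

theorem countable_finitary [Finite S] : Countable (finitary S) := by
  have h : (finitary S : Set (treeAut S)) = ⋃ n, {g | HasDepth g n} := by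
    ext g
    simp [mem_finitary]
  refine Set.Countable.to_subtype (s := (finitary S : Set (treeAut S))) ?_
  rw [h]
  refine Set.countable_iUnion fun n => ?_
  have : Finite {σ : List S // σ.length = n} := inferInstanceAs (Finite (List.Vector S n))
  let F : treeAut S → ({σ : List S // σ.length = n} → List S) := fun g σ => g • σ.1
  refine Set.MapsTo.countable_of_injOn (f := F) (t := Set.univ) (fun _ _ => trivial) ?_
    Set.countable_univ
  intro g hg k hk hgk
  have h1 : ∀ σ : List S, σ.length = n → g • σ = k • σ := fun σ hσ => congrFun hgk ⟨σ, hσ⟩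
  have h2 : ∀ σ : List S, n ≤ σ.length → g • σ = k • σ := by
    intro σ hσ
    have hl : (σ.take n).length = n := by simp [hσ]
    rw [← List.take_append_drop n σ, hg _ _ hl, hk _ _ hl, h1 _ hl]
  refine treeAut_ext fun v => ?_
  rcases v with _ | ⟨s, v⟩
  · rw [smul_nil, smul_nil]
  -- Words shorter than `n` are padded past level `n`; the images of the padded word agree, hence so
  -- do their prefixes of equal length.
  · have hp : s :: v <+: (s :: v) ++ List.replicate n s := List.prefix_append _ _
    have hg' := smul_prefix_smul g hp
    have hk' := smul_prefix_smul k hp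
    rw [h2 (s :: v ++ List.replicate n s)
      (by rw [List.length_append, List.length_replicate]; omega)] at hg'
    have hl : (g • (s :: v)).length = (k • (s :: v)).length := by
      rw [length_smul, length_smul]
    exact List.IsPrefix.eq_of_length (List.prefix_of_prefix_length_le hg' hk' hl.le) hl

/-! ### Rays and finite orbits of parabolic subgroups -/

theorem length_rayVertex (e : ℕ → S) (n : ℕ) : (rayVertex e n).length = n := by
  simp [rayVertex]

theorem rayVertex_prefix (e : ℕ → S) {m n : ℕ} (h : m ≤ n) : rayVertex e m <+: rayVertex e n := by
  obtain ⟨k, rfl⟩ := Nat.exists_eq_add_of_le h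
  simp [rayVertex, List.range_add]

theorem mem_parabolic {G : Subgroup (treeAut S)} {e : ℕ → S} {g : G} :
    g ∈ parabolic G e ↔ ∀ n, g • rayVertex e n = rayVertex e n := by
  simp [parabolic, Subgroup.mem_iInf]

theorem ray_ext {e f : ℕ → S} (h : ∀ n, rayVertex e n = rayVertex f n) : e = f := by
  funext n
  have h1 := h (n + 1)
  simp only [rayVertex, List.range_succ, List.map_append] at h1
  simpa using (List.append_inj' h1 rfl).2

/-- In a weakly branch, spherically transitive group, a geodesic `w` is moved by an element
supported below any given vertex `w m` of it. -/
theorem exists_moving {G : Subgroup (treeAut S)} (hT : IsSphericallyTransitive G)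
    (hB : IsWeaklyBranch G) (w : ℕ → List S) (hl : ∀ n, (w n).length = n)
    (hw : ∀ {m n}, m ≤ n → w m <+: w n) (m : ℕ) :
    ∃ k ∈ G, (∀ τ : List S, ¬ w m <+: τ → k • τ = τ) ∧ ∃ n, k • w n ≠ w n := by
  obtain ⟨k, ⟨⟨a, -, hka⟩, hkG⟩, hk1⟩ := (hB (w m)).exists_notMem_finset {1}
  obtain ⟨u, hu⟩ : ∃ u : List S, k • u ≠ u := by
    by_contra! h
    exact hk1 (by simpa using treeAut_ext (h := 1) h)
  have hmu : w m <+: u := by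
    by_contra h
    exact hu (hka.2 u h)
  have hml : m ≤ u.length := by simpa [hl] using hmu.length_le
  -- The moved vertex `u` is carried onto the geodesic. Since `u` lies below `w m`, `g` fixes `w m`,
  -- so conjugating `k` by `g` keeps its support below `w m`.
  obtain ⟨⟨g, hgG⟩, hg⟩ := hT u.length u (w u.length) rfl (hl _)
  replace hg : g • u = w u.length := hg
  have hgm : g • w m = w m := by
    have h1 := smul_prefix_smul g hmu
    rw [hg] at h1
    have h2 : (g • w m).length = (w m).length := length_smul _ _
    exact (List.prefix_of_prefix_length_le h1 (hw hml) h2.le).eq_of_length h2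
  refine ⟨g * k * g⁻¹, mul_mem (mul_mem hgG hkG) (inv_mem hgG), fun τ hτ => ?_, u.length, ?_⟩
  · rw [mul_smul, mul_smul, hka.2, smul_inv_smul]
    intro h
    have h1 := smul_prefix_smul g h
    rw [hgm, smul_inv_smul] at h1
    exact hτ h1
  · rw [← hg, mul_smul, mul_smul, inv_smul_smul]
    exact fun h => hu (MulAction.injective g h)

/-- A ray other than `e` has infinite orbit under the stabiliser of `e`. -/
theorem forall_smul_rayVertex_eq_of_finite_orbit {G : Subgroup (treeAut S)}
    (hT : IsSphericallyTransitive G) (hB : IsWeaklyBranch G) (e f : ℕ → S) (x : G)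
    (hfin : (MulAction.orbit (parabolic G e) (x : G ⧸ parabolic G f)).Finite) (n : ℕ) :
    x • rayVertex f n = rayVertex e n := by
  by_contra hn
  have hl : ∀ i, (x • rayVertex f i).length = i := fun i =>
    (length_smul x.1 _).trans (length_rayVertex f i)
  have hpre : ∀ {i j}, i ≤ j → x • rayVertex f i <+: x • rayVertex f j := fun h =>
    smul_prefix_smul x.1 (rayVertex_prefix f h)
  choose k hkG hk hmove using exists_moving hT hB (fun i => x • rayVertex f i) hl hpre
  -- The rays `x f` and `e` already differ at level `n`, so nothing on `e` lies in the support of `k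
  -- (n + i)`.
  have hkP : ∀ i, (⟨k (n + i), hkG _⟩ : G) ∈ parabolic G e := by
    refine fun i => mem_parabolic.2 fun j => hk _ _ fun h => hn ?_
    have hx : x • rayVertex f n <+: rayVertex e j := (hpre (Nat.le_add_right n i)).trans h
    have hnj : n ≤ j := by simpa [hl, length_rayVertex] using hx.length_le
    have h2 : (x • rayVertex f n).length = (rayVertex e n).length := by
      rw [hl, length_rayVertex]
    exact (List.prefix_of_prefix_length_le hx (rayVertex_prefix e hnj) h2.le).eq_of_length h2
  have : Finite (MulAction.orbit (parabolic G e) (x : G ⧸ parabolic G f)) := hfin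
  obtain ⟨c, hc⟩ := Finite.exists_infinite_fiber fun i : ℕ =>
    (⟨(⟨_, hkP i⟩ : parabolic G e) • (x : G ⧸ parabolic G f), MulAction.mem_orbit _ _⟩ :
      MulAction.orbit (parabolic G e) (x : G ⧸ parabolic G f))
  rw [Set.infinite_coe_iff] at hc
  obtain ⟨i, hi⟩ := hc.nonempty
  obtain ⟨l, hlm⟩ := hmove (n + i)
  -- `k (n + i)` moves the vertex of `x f` at level `l`, while `k (n + j)` with `j > l` is supported
  -- too deep to move it; so they cannot send the coset of `x` to the same place.
  obtain ⟨j, hj, hlj⟩ := hc.exists_gt l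
  have hij : ((⟨k (n + i), hkG _⟩ * x : G) : G ⧸ parabolic G f) =
      ((⟨k (n + j), hkG _⟩ * x : G) : G ⧸ parabolic G f) :=
    congrArg Subtype.val ((show _ = c from hi).trans (show _ = c from hj).symm)
  have h3 := mem_parabolic.1 (QuotientGroup.eq.1 hij) l
  rw [mul_smul, inv_smul_eq_iff, mul_smul, mul_smul] at h3
  refine hlm (h3.symm.trans (hk _ _ fun h => ?_))
  have h4 := h.length_le
  rw [hl, hl] at h4
  omega

end TreeGroup

/-! ### Invariant vectors in quasi-regular representations -/

namespace UnitaryRep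

universe u

variable {G : Type u} [Group G]

theorem finite_setOf_norm_ge {P : Subgroup G} (v : cosetSpace P) {ε : ℝ} (hε : 0 < ε) :
    {x | ε ≤ ‖v x‖}.Finite := by
  have h2 : (0 : ℝ) < (2 : ℝ≥0∞).toReal := by norm_num
  have h1 := ((lp.memℓp v).summable h2).tendsto_cofinite_zero.eventually
    (gt_mem_nhds (show (0 : ℝ) < ε ^ (2 : ℝ≥0∞).toReal by positivity))
  refine Set.Finite.subset (Filter.eventually_cofinite.1 h1) fun x hx => ?_
  exact not_lt.2 (Real.rpow_le_rpow hε.le hx h2.le)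

/-- An `ℓ²`-function invariant under `Q` vanishes off the finite orbits of `Q`. -/
theorem finite_orbit_of_invariant {P Q : Subgroup G} (v : cosetSpace P)
    (hv : ∀ q ∈ Q, translate P q v = v) {x : G ⧸ P} (hx : v x ≠ 0) :
    (MulAction.orbit Q x).Finite := by
  -- `v` is constant along the orbit, and only finitely many of its values are this large.
  refine (finite_setOf_norm_ge v (norm_pos_iff.2 hx)).subset ?_
  rintro _ ⟨q, rfl⟩
  have h1 : v ((q : G) • x) = v x := by
    conv_lhs => rw [← hv q q.2]
    rw [translate_apply, inv_smul_smul]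
  exact (congrArg norm h1).ge

open Classical in
/-- The point mass at a coset. -/
noncomputable def delta {P : Subgroup G} (x : G ⧸ P) : cosetSpace P := lp.single 2 x (1 : ℂ)

theorem delta_apply_self {P : Subgroup G} (x : G ⧸ P) : delta x x = 1 := by
  simp [delta]

theorem delta_apply_of_ne {P : Subgroup G} {x y : G ⧸ P} (h : y ≠ x) : delta x y = 0 := by
  simp [delta, h]

theorem inner_delta {P : Subgroup G} (x : G ⧸ P) (v : cosetSpace P) :
    inner ℂ (delta x) v = v x := by
  classical
  simp [delta, lp.inner_single_left]

theorem translate_delta {P : Subgroup G} (g : G) (x : G ⧸ P) :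
    translate P g (delta x) = delta (g • x) := by
  ext y
  rw [translate_apply]
  by_cases h : y = g • x
  · rw [h, inv_smul_smul, delta_apply_self, delta_apply_self]
  · rw [delta_apply_of_ne h, delta_apply_of_ne]
    rwa [Ne, inv_smul_eq_iff]

theorem translate_delta_of_mem {P : Subgroup G} {g : G} (hg : g ∈ P) :
    translate P g (delta ((1 : G) : G ⧸ P)) = delta ((1 : G) : G ⧸ P) := by
  rw [translate_delta]
  congr 1
  exact QuotientGroup.eq.2 (by simpa using hg)

theorem inner_translate {P : Subgroup G} (g : G) (v w : cosetSpace P) :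
    inner ℂ (translate P g v) (translate P g w) = inner ℂ v w :=
  (quasiRegular P g).inner_map_map v w

/-- A quasi-regular representation is irreducible if the subgroup has no finite orbit on its coset
space other than the base point. -/
theorem isIrreducible_quasiRegular (P : Subgroup G)
    (hP : ∀ x : G ⧸ P, (MulAction.orbit P x).Finite → x = ((1 : G) : G ⧸ P)) :
    IsIrreducible (quasiRegular P) := by
  refine ⟨⟨⟨delta ((1 : G) : G ⧸ P), 0, fun h => ?_⟩⟩, fun K hKc hK => ?_⟩
  · have h1 := delta_apply_self ((1 : G) : G ⧸ P)
    rw [h] at h1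
    simp at h1
  have hK' : ∀ g, ∀ v ∈ K, translate P g v ∈ K := hK
  have : CompleteSpace K := hKc.completeSpace_coe
  set d : cosetSpace P := delta ((1 : G) : G ⧸ P) with hd
  set p : cosetSpace P := K.starProjection d with hp
  have hpK : p ∈ K := K.starProjection_apply_mem d
  have hpinv : ∀ q ∈ P, translate P q p = p := by
    intro q hq
    -- By uniqueness of the projection: `q` fixes `d`, so `d - q p = q (d - p)`, which is orthogonal
    -- to the invariant subspace `K`.
    refine (Submodule.eq_starProjection_of_mem_of_inner_eq_zero (hK' q p hpK) fun w hw => ?_).symm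
    have h1 : d - translate P q p = translate P q (d - p) := by
      conv_lhs => rw [hd, ← translate_delta_of_mem hq, ← hd]
      exact (map_sub (quasiRegular P q) d p).symm
    have h2 : w = translate P q (translate P q⁻¹ w) := by
      rw [← translate_mul, mul_inv_cancel, translate_one]
    rw [h1, h2, inner_translate]
    exact Submodule.starProjection_inner_eq_zero d _ (hK' _ w hw)
  have hpd : p = p ((1 : G) : G ⧸ P) • d := by
    ext x
    rw [lp.coeFn_smul, Pi.smul_apply, smul_eq_mul]
    by_cases hx : x = ((1 : G) : G ⧸ P)
    · rw [hx, delta_apply_self, mul_one]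
    · rw [hd, delta_apply_of_ne hx, mul_zero]
      by_contra h
      exact hx (hP x (finite_orbit_of_invariant p hpinv h))
  -- If `p = 0`, then `d` is orthogonal to `K`: vectors of `K` vanish at the base coset and, by
  -- translation, everywhere. Otherwise `K` contains `d`, hence every point mass.
  by_cases hc : p ((1 : G) : G ⧸ P) = 0
  · left
    rw [hc, zero_smul] at hpd
    rw [eq_bot_iff]
    intro v hv
    have h0 : ∀ w ∈ K, w ((1 : G) : G ⧸ P) = 0 := by
      intro w hw
      have h1 := Submodule.starProjection_inner_eq_zero (K := K) d w hw
      rwa [← hp, hpd, sub_zero, inner_delta] at h1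
    rw [Submodule.mem_bot]
    ext x
    obtain ⟨g, rfl⟩ := QuotientGroup.mk_surjective x
    have h1 := h0 _ (hK' g⁻¹ v hv)
    rw [translate_apply, inv_inv] at h1
    have h2 : g • ((1 : G) : G ⧸ P) = (g : G ⧸ P) := congrArg QuotientGroup.mk (mul_one g)
    rw [h2] at h1
    exact h1
  · right
    have hdK : d ∈ K := by
      rw [hpd] at hpK
      exact (K.smul_mem_iff hc).1 hpK
    have hall : ∀ x : G ⧸ P, delta x ∈ K := by
      intro x
      obtain ⟨g, rfl⟩ := QuotientGroup.mk_surjective x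
      have h1 := hK' g d hdK
      rwa [hd, translate_delta, MulAction.Quotient.smul_coe, smul_eq_mul, mul_one] at h1
    rw [← K.orthogonal_eq_bot_iff, eq_bot_iff]
    intro v hv
    rw [Submodule.mem_bot]
    ext x
    rw [← inner_delta]
    exact Submodule.inner_right_of_mem_orthogonal (hall x) hv

/-- If two quasi-regular representations are equivalent, the first subgroup has a finite orbit on
the cosets of the second. -/
theorem Equivalent.exists_finite_orbit {P Q : Subgroup G}
    (h : Equivalent (quasiRegular P) (quasiRegular Q)) :
    ∃ x : G, (MulAction.orbit P (x : G ⧸ Q)).Finite := by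
  obtain ⟨U, hU⟩ := h
  set v : cosetSpace Q := U (delta ((1 : G) : G ⧸ P)) with hv
  -- The base point mass is fixed by `P`, so its image under the intertwiner is too.
  have hinv : ∀ p ∈ P, translate Q p v = v := by
    intro p hp
    have h1 := hU p (delta ((1 : G) : G ⧸ P))
    rw [show quasiRegular P p (delta ((1 : G) : G ⧸ P)) = _ from translate_delta_of_mem hp] at h1
    exact h1.symm
  obtain ⟨x, hx⟩ : ∃ x, v x ≠ 0 := by
    by_contra! h0
    have hv0 : v = 0 := by
      ext x
      exact h0 x
    have h1 := delta_apply_self ((1 : G) : G ⧸ P)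
    rw [U.map_eq_zero_iff.1 hv0] at h1
    simp at h1
  obtain ⟨g, rfl⟩ := QuotientGroup.mk_surjective x
  exact ⟨g, finite_orbit_of_invariant v hinv hx⟩

end UnitaryRep

/-! ### Uncountably many orbits of rays -/

namespace TreeGroup

universe u

variable {S : Type u}

/-- Two rays are in the same orbit under `G`. -/
def raySetoid (G : Subgroup (treeAut S)) : Setoid (ℕ → S) where
  r e f := ∃ g : G, ∀ n, g • rayVertex f n = rayVertex e n
  iseqv :=
    { refl := fun e => ⟨1, fun n => one_smul _ _⟩
      symm := fun ⟨g, hg⟩ => ⟨g⁻¹, fun n => by rw [← hg, inv_smul_smul]⟩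
      trans := fun ⟨g, hg⟩ ⟨h, hh⟩ => ⟨g * h, fun n => by rw [mul_smul, hh, hg]⟩ }

/-- The classes of rays under a countable group are countable, so that a set of representatives is
uncountable. -/
theorem exists_uncountable_transversal [Nontrivial S] (G : Subgroup (treeAut S)) [Countable G] :
    ∃ E : Set (ℕ → S), ¬ E.Countable ∧
      E.Pairwise fun e f => ¬ ∃ g : G, ∀ n, g • rayVertex f n = rayVertex e n := by
  refine ⟨Set.range (Quotient.out (s := raySetoid G)), fun hE => ?_, ?_⟩
  · have hu : (Set.univ : Set (ℕ → S)) = ⋃ f ∈ Set.range (Quotient.out (s := raySetoid G)),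
        {e | ∃ g : G, ∀ n, g • rayVertex f n = rayVertex e n} := by
      refine (Set.eq_univ_of_forall fun e => ?_).symm
      exact Set.mem_biUnion (Set.mem_range_self (Quotient.mk (raySetoid G) e))
        (Setoid.symm' (raySetoid G) (Quotient.mk_out (s := raySetoid G) e))
    have hc : (Set.univ : Set (ℕ → S)).Countable := by
      rw [hu]
      refine hE.biUnion fun f _ => ?_
      rw [Set.ofPred_exists]
      -- For fixed `f`, each `g` determines at most one ray `e`.
      refine Set.countable_iUnion fun g => Set.Subsingleton.countable fun e he e' he' => ?_
      exact ray_ext fun n => (he n).symm.trans (he' n)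
    have : Countable (ℕ → S) := Set.countable_univ_iff.1 hc
    -- Cantor's diagonal argument: `d` differs from the ray `φ n` at position `n`.
    obtain ⟨φ, hφ⟩ := exists_surjective_nat (ℕ → S)
    choose d hd using fun n => exists_ne (φ n n)
    obtain ⟨n, hn⟩ := hφ d
    exact hd n (congrFun hn n).symm
  · rintro _ ⟨a, rfl⟩ _ ⟨b, rfl⟩ hab h
    refine hab (congrArg _ ?_)
    rw [← Quotient.out_eq a, ← Quotient.out_eq b]
    exact Quotient.sound h

end TreeGroup

theorem mainTheorem7 (S : Type*) [Finite S] [Nontrivial S] :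
    (∃ G : Subgroup (TreeGroup.treeAut S), Countable G ∧ TreeGroup.IsSphericallyTransitive G ∧
      TreeGroup.IsFractal G ∧ TreeGroup.IsWeaklyBranch G) ∧
    ∀ G : Subgroup (TreeGroup.treeAut S), TreeGroup.IsSphericallyTransitive G →
      TreeGroup.IsFractal G → TreeGroup.IsWeaklyBranch G →
      (∀ e : ℕ → S,
        UnitaryRep.IsIrreducible (UnitaryRep.quasiRegular (TreeGroup.parabolic G e))) ∧
      (Countable G → ∃ E : Set (ℕ → S), ¬ E.Countable ∧
        E.Pairwise fun e f => ¬ UnitaryRep.Equivalent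
          (UnitaryRep.quasiRegular (TreeGroup.parabolic G e))
          (UnitaryRep.quasiRegular (TreeGroup.parabolic G f))) := by
  refine ⟨⟨TreeGroup.finitary S, TreeGroup.countable_finitary,
    TreeGroup.isSphericallyTransitive_finitary, TreeGroup.isFractal_finitary,
    TreeGroup.isWeaklyBranch_finitary⟩, fun G hT _ hB => ⟨fun e => ?_, fun _ => ?_⟩⟩
  · refine UnitaryRep.isIrreducible_quasiRegular _ fun x hx => ?_
    obtain ⟨g, rfl⟩ := QuotientGroup.mk_surjective x
    -- For `f = e` the conclusion says that `g` fixes `e`, so its coset is the base point.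
    have h := TreeGroup.forall_smul_rayVertex_eq_of_finite_orbit hT hB e e g hx
    exact (QuotientGroup.eq.2 (by simpa using TreeGroup.mem_parabolic.2 h)).symm
  · obtain ⟨E, hE, hpair⟩ := TreeGroup.exists_uncountable_transversal G
    refine ⟨E, hE, hpair.mono' fun e f hef hequiv => hef ?_⟩
    obtain ⟨x, hx⟩ := hequiv.exists_finite_orbit
    exact ⟨x, TreeGroup.forall_smul_rayVertex_eq_of_finite_orbit hT hB e f x hx⟩
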